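/- Let $m\ge 2$ and $n\ge 1$ be integers and let $a=x_0<x_1<\dots<x_n=b$ be an arbitrary partition of $I=[a,b]$. Put $t_i=x_i$ for $0\le i\le n$, with multiple knots $t_i=a$ for $i\le 0$ and $t_i=b$ for $i\ge n$. Let $J=\{0,1,\dots,m+n-1\}$ and, for $j\in J$, let $B_j$ be the normalized B-spline of degree $m$ on these knots with support $[t_{j-m},t_{j+1}]$ (so $\sum_{j\in J}B_j=1$ on $I$). With $E_m=\{-m+1,\dots,0\}$ set $$\theta_j=\frac1m\sum_{s\in E_m}t_{j+s},\qquad \theta_j^{(2)}=\frac{2}{m(m-1)}\sum_{r,s\in E_m,\ r<s}t_{j+r}t_{j+s},\qquad \lambda_j=\theta_j^2-\theta_j^{(2)},$$ and define, for $f\in C(I)$, $$S_2f=\sum_{j\in J}\mu_j(f)\,B_j,\qquad \mu_j(f)=f(\theta_j)-\lambda_j\,[\theta_{j-1},\theta_j,\theta_{j+1}]f,$$ where $[\theta_{j-1},\theta_j,\theta_{j+1}]f$ is the second order divided difference; for $j=0$ and $j=m+n-1$ one has $\lambda_j=0$, and $\mu_j(f)=f(\theta_j)$. Then $S_2$ is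 exact on the space $\Pi_2$ of polynomials of degree at most $2$, i.e. $S_2p=p$ on $I$ for all $p\in\Pi_2$, and its operator norm on $C(I)$ with the uniform norm satisfies $$\Vert S_2\Vert_\infty\le\Big\lfloor \frac{m+4}{2}\Big\rfloor .$$ In particular, for each degree $m$ the operators $S_2$ are bounded uniformly in the partition. -/

import Mathlib

namespace QuasiInterpolant

noncomputable section

/-- The interval `I = [a, b]` of a partition `a = x 0 < x 1 < ⋯ < x n = b`. -/
abbrev I {n : ℕ} (x : Fin (n + 1) → ℝ) : Set ℝ := Set.Icc (x 0) (x (Fin.last n))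

/-- The knots: `t i = x i` for `0 ≤ i ≤ n`, with multiple knots `t i = a` for `i ≤ 0`
and `t i = b` for `i ≥ n`. -/
def knot {n : ℕ} (x : Fin (n + 1) → ℝ) (i : ℤ) : ℝ :=
  x ⟨min i.toNat n, by omega⟩

/-- Normalized B-splines by the Cox-de Boor recursion: `bspline x k i` has degree `k` and support
`[t i, t (i + k + 1)]`; quotients with denominator `0` count as `0`.  In degree `0` it is the
indicator of `[t i, t (i + 1))`, the last nonempty interval being closed at `b`. -/
def bspline {n : ℕ} (x : Fin (n + 1) → ℝ) : ℕ → ℤ → ℝ → ℝ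
  | 0, i, y =>
      open Classical in
      if knot x i ≤ y ∧ (y < knot x (i + 1) ∨
          (knot x i < knot x (i + 1) ∧ knot x (i + 1) = x (Fin.last n) ∧ y = x (Fin.last n)))
      then 1 else 0
  | k + 1, i, y =>
      (y - knot x i) / (knot x (i + k + 1) - knot x i) * bspline x k i y +
      (knot x (i + k + 2) - y) / (knot x (i + k + 2) - knot x (i + 1)) * bspline x k (i + 1) y

theorem knot_mono {n : ℕ} {x : Fin (n + 1) → ℝ} (hx : StrictMono x) : Monotone (knot x) := by
  intro i j hij
  apply hx.monotone
  rw [Fin.mk_le_mk]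
  omega

theorem knot_mem {n : ℕ} {x : Fin (n + 1) → ℝ} (hx : StrictMono x) (i : ℤ) : knot x i ∈ I x :=
  ⟨hx.monotone (Fin.zero_le _), hx.monotone (Fin.le_last _)⟩

theorem knot_eq_succ {n : ℕ} {x : Fin (n + 1) → ℝ} (hx : StrictMono x) {i : ℤ}
    (h : knot x i = knot x (i + 1)) :
    knot x (i + 1) = x 0 ∨ knot x i = x (Fin.last n) := by
  have h1 := hx.injective h
  rw [Fin.mk.injEq] at h1
  by_cases hi : i + 1 ≤ 0
  · left
    unfold knot
    congr 1
    ext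
    simp
    omega
  · right
    unfold knot
    congr 1
    ext
    simp
    omega

theorem bspline_one_continuousOn {n : ℕ} {x : Fin (n + 1) → ℝ} (hx : StrictMono x) (i : ℤ) :
    ContinuousOn (bspline x 1 i) (I x) := by
  have hpq : knot x i ≤ knot x (i + 1) := knot_mono hx (by omega)
  have hqr : knot x (i + 1) ≤ knot x (i + 2) := knot_mono hx (by omega)
  have e := @knot_eq_succ n x hx i
  have e' := @knot_eq_succ n x hx (i + 1)
  have hp := knot_mem hx i
  have hq := knot_mem hx (i + 1)
  have hr := knot_mem hx (i + 2)
  have h2 : i + 1 + 1 = i + 2 := by ring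
  rw [h2] at e'
  have key : ∀ y, bspline x 1 i y =
      (y - knot x i) / (knot x (i + 1) - knot x i) * bspline x 0 i y +
      (knot x (i + 2) - y) / (knot x (i + 2) - knot x (i + 1)) * bspline x 0 (i + 1) y := by
    intro y
    simp [bspline]
  generalize bspline x 1 i = F at *
  simp only [bspline, h2] at key
  simp only [I, Set.mem_Icc] at hp hq hr ⊢
  generalize knot x i = p at *
  generalize knot x (i + 1) = q at *
  generalize knot x (i + 2) = r at *
  generalize x (Fin.last n) = b at *
  generalize x 0 = a at *
  rcases hpq.eq_or_lt with rfl | hpq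
  · rcases hqr.eq_or_lt with rfl | hqr
    · refine (continuousOn_const (c := (0 : ℝ))).congr fun y _ => ?_
      simp [key]
    · have : ContinuousOn (fun y => max 0 ((r - y) / (r - p))) (Set.Icc a b) := by fun_prop
      refine this.congr fun y hy => ?_
      have hpa : p = a := by
        rcases e rfl with h | h
        · exact h
        · linarith
      obtain ⟨hy1, hy2⟩ := hy
      rw [key]
      have hd : 0 < r - p := by linarith
      by_cases hyr : y < r
      · have : 0 ≤ (r - y) / (r - p) := div_nonneg (by linarith) hd.le
        rw [if_pos (c := p ≤ y ∧ (y < r ∨ _)) ⟨by linarith, Or.inl hyr⟩]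
        simp [this]
      · have h0 : (r - y) / (r - p) ≤ 0 := div_nonpos_of_nonpos_of_nonneg (by linarith) hd.le
        by_cases hyr' : y = r
        · subst hyr'
          simp
        · have : ¬ (r = b ∧ y = b) := fun h => hyr' (h.2.trans h.1.symm)
          simp [h0, hyr, this]
  · rcases hqr.eq_or_lt with rfl | hqr
    · have : ContinuousOn (fun y => max 0 ((y - p) / (q - p))) (Set.Icc a b) := by fun_prop
      refine this.congr fun y hy => ?_
      have hqb : q = b := by
        rcases e' rfl with h | h
        · linarith
        · exact h
      subst hqb
      obtain ⟨hy1, hy2⟩ := hy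
      rw [key]
      have hd : 0 < q - p := by linarith
      by_cases hyp : p ≤ y
      · have : 0 ≤ (y - p) / (q - p) := div_nonneg (by linarith) hd.le
        have h3 : y < q ∨ y = q := hy2.lt_or_eq
        simp [this, hyp, hpq, h3]
      · have h0 : (y - p) / (q - p) ≤ 0 := div_nonpos_of_nonpos_of_nonneg (by linarith) hd.le
        simp [hyp, h0]
    · have : ContinuousOn (fun y => max 0 (min ((y - p) / (q - p)) ((r - y) / (r - q))))
          (Set.Icc a b) := by fun_prop
      refine this.congr fun y hy => ?_
      obtain ⟨hy1, hy2⟩ := hy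
      rw [key]
      have hd : 0 < q - p := by linarith
      have hd' : 0 < r - q := by linarith
      have hqb : q ≠ b := by
        intro h
        linarith
      have e1 : (y - p) / (q - p) ≤ 1 ↔ y ≤ q := by
        rw [div_le_one hd]
        constructor <;> intro h <;> linarith
      have e2 : (r - y) / (r - q) ≤ 1 ↔ q ≤ y := by
        rw [div_le_one hd']
        constructor <;> intro h <;> linarith
      have e3 : 0 ≤ (y - p) / (q - p) ↔ p ≤ y := by
        rw [le_div_iff₀ hd]
        constructor <;> intro h <;> linarith
      have e4 : 0 ≤ (r - y) / (r - q) ↔ y ≤ r := by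
        rw [le_div_iff₀ hd']
        constructor <;> intro h <;> linarith
      by_cases c1 : y < q
      · have n2 : ¬ q ≤ y := by linarith
        have h2 := lt_of_not_ge (mt e2.1 (not_le.2 c1) : ¬ (r - y) / (r - q) ≤ 1)
        have h1 := e1.2 c1.le
        beta_reduce
        rw [min_eq_left (by linarith)]
        by_cases c0 : p ≤ y
        · simp [c0, c1, n2, e3.2 c0]
        · have := le_of_lt (lt_of_not_ge (mt e3.1 c0))
          simp [c0, n2, this]
      · have n1 : q ≤ y := by linarith
        have c0 : p ≤ y := by linarith
        have h2 := e2.2 n1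
        have h1 : 1 ≤ (y - p) / (q - p) := by
          rw [le_div_iff₀ hd]
          linarith
        beta_reduce
        rw [min_eq_right (by linarith)]
        by_cases cr : y < r
        · simp [c0, c1, n1, cr, hqb, e4.2 cr.le]
        · by_cases hyr' : y = r
          · subst hyr'
            simp [c0, c1, hqb]
          · have h0 := le_of_lt (lt_of_not_ge (mt e4.1 (fun h => cr (lt_of_le_of_ne h hyr'))))
            have : ¬ (r = b ∧ y = b) := fun h => hyr' (h.2.trans h.1.symm)
            simp [c0, c1, n1, cr, hqb, h0, this]

theorem bspline_continuousOn {n : ℕ} {x : Fin (n + 1) → ℝ} (hx : StrictMono x) (k : ℕ)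
    (hk : 1 ≤ k) : ∀ i : ℤ, ContinuousOn (bspline x k i) (I x) := by
  induction k, hk using Nat.le_induction with
  | base => exact bspline_one_continuousOn hx
  | succ k _ ih =>
    intro i
    have h1 := ih i
    have h2 := ih (i + 1)
    have : bspline x (k + 1) i = fun y =>
        (y - knot x i) / (knot x (i + k + 1) - knot x i) * bspline x k i y +
        (knot x (i + k + 2) - y) / (knot x (i + k + 2) - knot x (i + 1)) *
          bspline x k (i + 1) y := by
      funext y
      rw [bspline]
    rw [this]
    fun_prop

/-- `B j`, `0 ≤ j ≤ m + n - 1`: the B-spline of degree `m` with support `[t (j - m), t (j + 1)]`,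
as a continuous function on `I`. -/
def B {n : ℕ} (m : ℕ) (hm : 2 ≤ m) (x : Fin (n + 1) → ℝ) (hx : StrictMono x) (j : ℤ) :
    C(I x, ℝ) where
  toFun y := bspline x m (j - m) y
  continuous_toFun := (bspline_continuousOn hx m (by omega) (j - m)).domRestrict

/-- The index set `E_m = {-m + 1, …, 0}`. -/
abbrev E (m : ℕ) : Finset ℤ := Finset.Icc (-(m : ℤ) + 1) 0

/-- The knot averages `θ j = (1 / m) ∑ t (j + s)`, `s ∈ E_m`. -/
def theta {n : ℕ} (m : ℕ) (x : Fin (n + 1) → ℝ) (j : ℤ) : ℝ :=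
  1 / (m : ℝ) * ∑ s ∈ E m, knot x (j + s)

/-- `θ⁽²⁾ j = 2 / (m (m - 1)) ∑ t (j + r) t (j + s)`, `r < s` in `E_m`. -/
def thetaTwo {n : ℕ} (m : ℕ) (x : Fin (n + 1) → ℝ) (j : ℤ) : ℝ :=
  2 / ((m : ℝ) * ((m : ℝ) - 1)) *
    ∑ r ∈ E m, ∑ s ∈ E m with r < s, knot x (j + r) * knot x (j + s)

/-- `λ j = (θ j)² - θ⁽²⁾ j`. -/
def lam {n : ℕ} (m : ℕ) (x : Fin (n + 1) → ℝ) (j : ℤ) : ℝ :=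
  theta m x j ^ 2 - thetaTwo m x j

theorem theta_mem {n : ℕ} {m : ℕ} (hm : 2 ≤ m) {x : Fin (n + 1) → ℝ} (hx : StrictMono x)
    (j : ℤ) : theta m x j ∈ I x := by
  have hm0 : (0 : ℝ) < m := by exact_mod_cast (by omega : 0 < m)
  have hc : (E m).card = m := by simp
  have h1 := Finset.card_nsmul_le_sum (E m) (fun s => knot x (j + s)) (x 0)
    fun s _ => (knot_mem hx (j + s)).1
  have h2 := Finset.sum_le_card_nsmul (E m) (fun s => knot x (j + s)) (x (Fin.last n))
    fun s _ => (knot_mem hx (j + s)).2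
  rw [hc, nsmul_eq_mul] at h1 h2
  unfold theta
  rw [one_div, inv_mul_eq_div]
  constructor
  · rw [le_div_iff₀ hm0]
    linarith
  · rw [div_le_iff₀ hm0]
    linarith

/-- The points `θ j` as points of `I`. -/
def thetaPt {n : ℕ} (m : ℕ) (hm : 2 ≤ m) (x : Fin (n + 1) → ℝ) (hx : StrictMono x) (j : ℤ) :
    I x :=
  ⟨theta m x j, theta_mem hm hx j⟩

/-- The second order divided difference `[p, q, r] f` (for distinct points), as a functional. -/
def divDiff {s : Set ℝ} [CompactSpace s] (p q r : s) : C(s, ℝ) →L[ℝ] ℝ :=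
  ((r : ℝ) - p)⁻¹ •
    (((r : ℝ) - q)⁻¹ • (ContinuousMap.evalCLM ℝ r - ContinuousMap.evalCLM ℝ q) -
     ((q : ℝ) - p)⁻¹ • (ContinuousMap.evalCLM ℝ q - ContinuousMap.evalCLM ℝ p))

/-- The coefficient functional `μ j f = f (θ j) - λ j [θ (j - 1), θ j, θ (j + 1)] f`.
For `0 < j < m + n - 1` the three points are distinct.  For `j = 0` and `j = m + n - 1`
all knots entering `λ j` coincide, so `λ j = 0` and `μ j f = f (θ j)`, that is `f a`
and `f b`. -/
def mu {n : ℕ} (m : ℕ) (hm : 2 ≤ m) (x : Fin (n + 1) → ℝ) (hx : StrictMono x) (j : ℤ) :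
    C(I x, ℝ) →L[ℝ] ℝ :=
  ContinuousMap.evalCLM ℝ (thetaPt m hm x hx j) -
    lam m x j • divDiff (thetaPt m hm x hx (j - 1)) (thetaPt m hm x hx j)
      (thetaPt m hm x hx (j + 1))

/-- The discrete quasi-interpolant `S₂ f = ∑ μ j f • B j`, `j = 0, …, m + n - 1`, as a bounded
operator on `C(I)` with the uniform norm. -/
def S₂ {n : ℕ} (m : ℕ) (hm : 2 ≤ m) (x : Fin (n + 1) → ℝ) (hx : StrictMono x) :
    C(I x, ℝ) →L[ℝ] C(I x, ℝ) :=
  ∑ j ∈ Finset.range (m + n), (mu m hm x hx j).smulRight (B m hm x hx j)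

end

end QuasiInterpolant

/-! Exactness: the Cox-de Boor recursion lowers the degree of a spline by acting on its coefficients
(`sum_bspline_succ`). Each step replaces an end knot by its weighted mean `y`, so induction on the
degree shows that `1`, `theta` and `thetaTwo` are the B-spline coefficients of `1`, `y` and `y ^ 2`.
Since `[p, q, r]` kills affine functions and sends `y ^ 2` to `1`, `mu` produces exactly these
coefficients on quadratics (`mu_polynomial`).

Norm: the B-splines are nonnegative and sum to `1`, so it suffices to bound each `mu`. With `d₁`,
`d₂` the gaps between the three consecutive `theta`, the bound is `1 + 2 * lam / (d₁ * d₂)`. Both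
gaps are at least `h = (t j - t (j - m + 1)) / m`, while `lam` is a scaled variance of the knots
between these two ends, hence at most `⌊m ^ 2 / 4⌋ / (m - 1) * h ^ 2` (`lam_le`, `lam_eq_zero_or`).
So `h` cancels and no mesh ratio enters; `one_add_two_mul_le_floor` finishes. -/

namespace QuasiInterpolant

section Splines

variable {n : ℕ} {x : Fin (n + 1) → ℝ}

/-! ### Support and positivity of B-splines. -/

theorem bspline_succ (k : ℕ) (i : ℤ) (y : ℝ) :
    bspline x (k + 1) i y =
      (y - knot x i) / (knot x (i + k + 1) - knot x i) * bspline x k i y +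
      (knot x (i + k + 2) - y) / (knot x (i + k + 2) - knot x (i + 1)) *
        bspline x k (i + 1) y := by
  rw [bspline]

theorem bspline_eq_zero_of_lt (hx : StrictMono x) {y : ℝ} (k : ℕ) :
    ∀ i : ℤ, y < knot x i → bspline x k i y = 0 := by
  induction k with
  | zero =>
    intro i h
    simp [bspline, not_le.2 h]
  | succ k ih =>
    intro i h
    rw [bspline_succ, ih i h, ih (i + 1) (h.trans_le (knot_mono hx (by omega)))]
    simp

theorem bspline_eq_zero_of_gt (hx : StrictMono x) {y : ℝ} (k : ℕ) :
    ∀ i : ℤ, knot x (i + k + 1) < y → bspline x k i y = 0 := by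
  induction k with
  | zero =>
    intro i h
    have h' : knot x (i + 1) < y := by simpa using h
    rw [bspline, if_neg]
    rintro ⟨-, h1 | ⟨-, h1, h2⟩⟩ <;> linarith
  | succ k ih =>
    intro i h
    have h' : knot x (i + 1 + k + 1) < y := by
      convert h using 2
      push_cast
      ring
    rw [bspline_succ, ih (i + 1) h', ih i ((knot_mono hx (by omega)).trans_lt h')]
    simp

/-- This disposes of zero denominators in the recursion and kills the two boundary terms in
`sum_bspline_succ`. -/
theorem bspline_eq_zero_of_knot_eq (hx : StrictMono x) {y : ℝ} (k : ℕ) :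
    ∀ i : ℤ, knot x i = knot x (i + k + 1) → bspline x k i y = 0 := by
  induction k with
  | zero =>
    intro i h
    have h' : knot x i = knot x (i + 1) := by simpa using h
    rw [bspline, if_neg]
    rintro ⟨h0, h1 | ⟨h1, -, -⟩⟩ <;> linarith
  | succ k ih =>
    intro i h
    have e : i + ((k + 1 : ℕ) : ℤ) + 1 = i + 1 + k + 1 := by
      push_cast
      ring
    rw [e] at h
    have h1 := knot_mono hx (show i ≤ i + 1 by omega)
    have h2 := knot_mono hx (show i + 1 ≤ i + 1 + k + 1 by omega)
    have h3 := knot_mono hx (show i ≤ i + k + 1 by omega)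
    have h4 := knot_mono hx (show i + k + 1 ≤ i + 1 + k + 1 by omega)
    rw [bspline_succ, ih i (by linarith), ih (i + 1) (by linarith)]
    simp

/-- A recursion weight is negative only where the lower-degree B-spline it multiplies vanishes. -/
theorem bspline_nonneg (hx : StrictMono x) (y : ℝ) (k : ℕ) :
    ∀ i : ℤ, 0 ≤ bspline x k i y := by
  induction k with
  | zero =>
    intro i
    rw [bspline]
    split_ifs <;> norm_num
  | succ k ih =>
    intro i
    rw [bspline_succ]
    refine add_nonneg ?_ ?_
    · rcases lt_or_ge y (knot x i) with h | h
      · rw [bspline_eq_zero_of_lt hx k i h, mul_zero]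
      · have := knot_mono hx (show i ≤ i + k + 1 by omega)
        exact mul_nonneg (div_nonneg (by linarith) (by linarith)) (ih i)
    · rcases lt_or_ge (knot x (i + k + 2)) y with h | h
      · have e : i + 1 + (k : ℤ) + 1 = i + k + 2 := by ring
        rw [bspline_eq_zero_of_gt hx k (i + 1) (by rwa [e]), mul_zero]
      · have := knot_mono hx (show i + 1 ≤ i + k + 2 by omega)
        exact mul_nonneg (div_nonneg (by linarith) (by linarith)) (ih (i + 1))

/-! ### Moments: the B-spline coefficients of `1`, `y` and `y ^ 2`. -/

theorem knot_of_nonpos {i : ℤ} (hi : i ≤ 0) : knot x i = x 0 := by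
  unfold knot
  congr 1
  ext
  simp
  omega

theorem knot_of_ge {i : ℤ} (hi : (n : ℤ) ≤ i) : knot x i = x (Fin.last n) := by
  unfold knot
  congr 1
  ext
  simp
  omega

theorem knot_lt_last (hx : StrictMono x) {i : ℤ} (hi : i < n) (hn : 1 ≤ n) :
    knot x i < x (Fin.last n) := by
  apply hx
  rw [Fin.lt_def]
  simp
  omega

theorem sum_bspline_zero (hx : StrictMono x) (hn : 1 ≤ n) {y : ℝ} (hy : y ∈ I x) :
    ∑ j ∈ Finset.range n, bspline x 0 j y = 1 := by
  classical
  -- The indicators telescope as differences of step functions; the cutoff `i < n` makes the last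
  -- interval closed at `b`.
  let H : ℕ → ℝ := fun i => if knot x i ≤ y ∧ i < n then 1 else 0
  have key : ∀ i ∈ Finset.range n, bspline x 0 i y = H i - H (i + 1) := by
    intro i hi
    rw [Finset.mem_range] at hi
    have hmono := knot_mono hx (show (i : ℤ) ≤ i + 1 by omega)
    have hlt := knot_lt_last hx (show (i : ℤ) < n by omega) hn
    simp only [bspline, H, Nat.cast_add, Nat.cast_one, hi, and_true]
    by_cases h1 : i + 1 < n
    · have hlt' := knot_lt_last hx (show (i : ℤ) + 1 < n by omega) hn
      simp only [hlt'.ne, h1, false_and, and_false, or_false, and_true]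
      by_cases c : knot x i ≤ y
      · by_cases d : y < knot x (i + 1)
        · simp [c, d, not_le.2 d]
        · simp [c, d, not_lt.1 d]
      · have : ¬ knot x (i + 1) ≤ y := fun h => c (hmono.trans h)
        simp [c, this]
    · have e : knot x ((i : ℤ) + 1) = x (Fin.last n) := knot_of_ge (by omega)
      have : y < x (Fin.last n) ∨ y = x (Fin.last n) := hy.2.lt_or_eq
      simp [e, h1, hlt, this]
  rw [Finset.sum_congr rfl key, Finset.sum_range_sub']
  have h0 : knot x 0 ≤ y := by
    rw [knot_of_nonpos le_rfl]
    exact hy.1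
  simp [H, h0, show 0 < n by omega]

/-- One step of the Cox-de Boor recursion on the coefficients of a spline. -/
theorem sum_bspline_succ (hx : StrictMono x) (y : ℝ) (k : ℕ) (c d : ℤ → ℝ)
    (hcd : ∀ i : ℤ, knot x i < knot x (i + k + 1) →
      c i * ((y - knot x i) / (knot x (i + k + 1) - knot x i)) +
        c (i - 1) * ((knot x (i + k + 1) - y) / (knot x (i + k + 1) - knot x i)) = d i) :
    ∑ j ∈ Finset.range (k + 1 + n), c (j - (k + 1 : ℕ)) * bspline x (k + 1) (j - (k + 1 : ℕ)) y =
      ∑ j ∈ Finset.range (k + n), d (j - k) * bspline x k (j - k) y := by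
  -- `P` and `Q` are the two halves of the recursion. Shifting `P` by one index aligns both on the
  -- same B-spline of degree `k`; the unmatched `P 0` and `Q (k + n)` sit on fully repeated knots.
  let P : ℕ → ℝ := fun j => c (j - k - 1) *
    ((y - knot x (j - k - 1)) / (knot x j - knot x (j - k - 1))) * bspline x k (j - k - 1) y
  let Q : ℕ → ℝ := fun j => c (j - k - 1) *
    ((knot x (j + 1) - y) / (knot x (j + 1) - knot x (j - k))) * bspline x k (j - k) y
  have h1 : ∀ j ∈ Finset.range (k + 1 + n),
      c (j - (k + 1 : ℕ)) * bspline x (k + 1) (j - (k + 1 : ℕ)) y = P j + Q j := by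
    intro j _
    rw [bspline_succ]
    have e1 : (j : ℤ) - (k + 1 : ℕ) = j - k - 1 := by push_cast; ring
    have e2 : (j : ℤ) - k - 1 + k + 1 = j := by ring
    have e3 : (j : ℤ) - k - 1 + k + 2 = j + 1 := by ring
    have e4 : (j : ℤ) - k - 1 + 1 = j - k := by ring
    rw [e1, e2, e3, e4]
    simp only [P, Q]
    ring
  have hP : P 0 = 0 := by
    have : bspline x k (((0 : ℕ) : ℤ) - k - 1) y = 0 := by
      apply bspline_eq_zero_of_knot_eq hx
      rw [knot_of_nonpos, knot_of_nonpos] <;> push_cast <;> omega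
    simp only [P, this, mul_zero]
  have hQ : Q (k + n) = 0 := by
    have : bspline x k (((k + n : ℕ) : ℤ) - k) y = 0 := by
      apply bspline_eq_zero_of_knot_eq hx
      rw [knot_of_ge, knot_of_ge] <;> push_cast <;> omega
    simp only [Q, this, mul_zero]
  rw [Finset.sum_congr rfl h1, Finset.sum_add_distrib, show k + 1 + n = k + n + 1 by ring,
    Finset.sum_range_succ' P, Finset.sum_range_succ Q, hP, hQ, add_zero, add_zero,
    ← Finset.sum_add_distrib]
  refine Finset.sum_congr rfl fun j _ => ?_
  have e1 : ((j + 1 : ℕ) : ℤ) - k - 1 = j - k := by push_cast; ring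
  have e2 : (j : ℤ) - k + k + 1 = j + 1 := by ring
  rcases (knot_mono hx (show (j : ℤ) - k ≤ j - k + k + 1 by omega)).eq_or_lt with h | h
  · have := bspline_eq_zero_of_knot_eq hx (y := y) k (j - k) h
    simp only [P, Q, e1, this, mul_zero, add_zero]
  · rw [← hcd _ h, e2]
    simp only [P, Q, e1]
    push_cast
    ring

/-- The sum of the `k` knots `t (i + 1), …, t (i + k)` inside the support of `bspline x k i`. -/
noncomputable def knotSum (x : Fin (n + 1) → ℝ) (k : ℕ) (i : ℤ) : ℝ :=
  ∑ s ∈ Finset.range k, knot x (i + 1 + s)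

/-- The sum of the squares of the knots `t (i + 1), …, t (i + k)`. -/
noncomputable def knotSqSum (x : Fin (n + 1) → ℝ) (k : ℕ) (i : ℤ) : ℝ :=
  ∑ s ∈ Finset.range k, knot x (i + 1 + s) ^ 2

theorem knotSum_succ (k : ℕ) (i : ℤ) :
    knotSum x (k + 1) i = knotSum x k i + knot x (i + k + 1) := by
  rw [knotSum, Finset.sum_range_succ, ← knotSum]
  congr 2
  ring

theorem knotSum_succ' (k : ℕ) (i : ℤ) :
    knotSum x (k + 1) (i - 1) = knotSum x k i + knot x i := by
  rw [knotSum, Finset.sum_range_succ', knotSum]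
  congr 1
  · refine Finset.sum_congr rfl fun s _ => ?_
    congr 1
    push_cast
    ring
  · simp

theorem knotSqSum_succ (k : ℕ) (i : ℤ) :
    knotSqSum x (k + 1) i = knotSqSum x k i + knot x (i + k + 1) ^ 2 := by
  rw [knotSqSum, Finset.sum_range_succ, ← knotSqSum]
  congr 3
  ring

theorem knotSqSum_succ' (k : ℕ) (i : ℤ) :
    knotSqSum x (k + 1) (i - 1) = knotSqSum x k i + knot x i ^ 2 := by
  rw [knotSqSum, Finset.sum_range_succ', knotSqSum]
  congr 1
  · refine Finset.sum_congr rfl fun s _ => ?_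
    congr 2
    push_cast
    ring
  · simp

/-- The two weights attached to one lower-degree B-spline sum to `1`, so constant coefficients
persist. -/
theorem sum_bspline (hx : StrictMono x) (hn : 1 ≤ n) {y : ℝ} (hy : y ∈ I x) (k : ℕ) :
    ∑ j ∈ Finset.range (k + n), bspline x k (j - k) y = 1 := by
  induction k with
  | zero => simpa using sum_bspline_zero hx hn hy
  | succ k ih =>
    have := sum_bspline_succ hx y k (fun _ => 1) (fun _ => 1) fun i hi => by
      have : knot x (i + k + 1) - knot x i ≠ 0 := by linarith
      field_simp
      ring
    simp only [one_mul] at this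
    rw [this, ih]

/-- The two coefficients involved are the inner knot sum plus one end knot each; the weights average
the end knots to `y`, so each degree contributes one more `y`. -/
theorem sum_knotSum_mul_bspline (hx : StrictMono x) (hn : 1 ≤ n) {y : ℝ} (hy : y ∈ I x) (k : ℕ) :
    ∑ j ∈ Finset.range (k + n), knotSum x k (j - k) * bspline x k (j - k) y = k * y := by
  induction k with
  | zero => simp [knotSum]
  | succ k ih =>
    rw [sum_bspline_succ hx y k (knotSum x (k + 1)) (fun i => knotSum x k i + y) fun i hi => by
      have : knot x (i + k + 1) - knot x i ≠ 0 := by linarith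
      rw [knotSum_succ, knotSum_succ']
      field_simp
      ring]
    simp only [add_mul, Finset.sum_add_distrib]
    rw [ih, ← Finset.mul_sum, sum_bspline hx hn hy]
    push_cast
    ring

/-- With `S`, `Q` the inner sums, `(S + t) ^ 2 - (Q + t ^ 2) = S ^ 2 - Q + 2 * t * S` is affine in
the end knot `t`, which again averages to `y`. The first moment then gives `k * (k - 1) + 2 * k = (k
+ 1) * k`. -/
theorem sum_knotSum_sq_sub_mul_bspline (hx : StrictMono x) (hn : 1 ≤ n) {y : ℝ} (hy : y ∈ I x)
    (k : ℕ) :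
    ∑ j ∈ Finset.range (k + n),
      (knotSum x k (j - k) ^ 2 - knotSqSum x k (j - k)) * bspline x k (j - k) y =
        k * (k - 1) * y ^ 2 := by
  induction k with
  | zero => simp [knotSum, knotSqSum]
  | succ k ih =>
    rw [sum_bspline_succ hx y k (fun i => knotSum x (k + 1) i ^ 2 - knotSqSum x (k + 1) i)
      (fun i => (knotSum x k i ^ 2 - knotSqSum x k i) + 2 * y * knotSum x k i) fun i hi => by
        have : knot x (i + k + 1) - knot x i ≠ 0 := by linarith
        rw [knotSum_succ, knotSum_succ', knotSqSum_succ, knotSqSum_succ']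
        field_simp
        ring]
    have h := sum_knotSum_mul_bspline hx hn hy k
    simp only [add_mul, Finset.sum_add_distrib, mul_assoc] at h ⊢
    rw [← Finset.mul_sum, ← Finset.mul_sum, h]
    simp only [mul_assoc] at ih
    rw [ih]
    push_cast
    ring

/-! ### `theta`, `thetaTwo` and `lam` through power sums, and the variance bound. -/

theorem sum_E (m : ℕ) (g : ℤ → ℝ) :
    ∑ s ∈ E m, g s = ∑ s ∈ Finset.range m, g (-m + 1 + s) := by
  refine Finset.sum_bij' (fun s _ => (s + m - 1).toNat) (fun s _ => -m + 1 + (s : ℤ))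
    ?_ ?_ ?_ ?_ ?_
  · intro s hs
    rw [Finset.mem_Icc] at hs
    rw [Finset.mem_range]
    omega
  · intro s hs
    rw [Finset.mem_range] at hs
    rw [Finset.mem_Icc]
    omega
  · intro s hs
    rw [Finset.mem_Icc] at hs
    omega
  · intro s hs
    omega
  · intro s hs
    rw [Finset.mem_Icc] at hs
    congr 1
    omega

theorem two_mul_sum_sum_lt {ι : Type*} [LinearOrder ι] (S : Finset ι) (g : ι → ℝ) :
    2 * ∑ r ∈ S, ∑ s ∈ S with r < s, g r * g s = (∑ r ∈ S, g r) ^ 2 - ∑ r ∈ S, g r ^ 2 := by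
  have h1 : ∑ r ∈ S, ∑ s ∈ S with r < s, g r * g s =
      ∑ r ∈ S, ∑ s ∈ S, if r < s then g r * g s else 0 := by
    simp only [Finset.sum_filter]
  have h2 : ∑ r ∈ S, ∑ s ∈ S with r < s, g r * g s =
      ∑ r ∈ S, ∑ s ∈ S, if s < r then g r * g s else 0 := by
    rw [h1, Finset.sum_comm]
    simp only [mul_comm]
  have h3 : ∑ r ∈ S, g r ^ 2 = ∑ r ∈ S, ∑ s ∈ S, if r = s then g r * g s else 0 := by
    refine Finset.sum_congr rfl fun r hr => ?_
    simp [hr, sq]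
  rw [two_mul]
  nth_rewrite 1 [h1]
  rw [h2, h3, sq, Finset.sum_mul_sum, eq_sub_iff_add_eq, ← Finset.sum_add_distrib,
    ← Finset.sum_add_distrib]
  refine Finset.sum_congr rfl fun r _ => ?_
  rw [← Finset.sum_add_distrib, ← Finset.sum_add_distrib]
  refine Finset.sum_congr rfl fun s _ => ?_
  rcases lt_trichotomy r s with h | h | h
  · simp [h, h.not_gt, h.ne]
  · simp [h]
  · simp [h, h.not_gt, h.ne']

theorem theta_eq (m : ℕ) (j : ℤ) : theta m x j = knotSum x m (j - m) / m := by
  rw [theta, sum_E, knotSum, one_div, inv_mul_eq_div]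
  congr 1
  refine Finset.sum_congr rfl fun s _ => ?_
  congr 1
  ring

theorem thetaTwo_eq (m : ℕ) (j : ℤ) :
    thetaTwo m x j = (knotSum x m (j - m) ^ 2 - knotSqSum x m (j - m)) / (m * (m - 1)) := by
  have e : ∀ s : ℕ, j + (-m + 1 + s) = j - m + 1 + s := fun s => by ring
  rw [thetaTwo, div_mul_eq_mul_div, two_mul_sum_sum_lt, sum_E, sum_E]
  simp only [e, knotSum, knotSqSum]

/-- The numerator is the sum of squared differences over pairs of knots, which gives both the sign
and the size of `lam`. -/
theorem lam_eq {m : ℕ} (hm : 2 ≤ m) (j : ℤ) :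
    lam m x j =
      (m * knotSqSum x m (j - m) - knotSum x m (j - m) ^ 2) / ((m : ℝ) ^ 2 * (m - 1)) := by
  have h2 : (2 : ℝ) ≤ m := by exact_mod_cast hm
  have h0 : (m : ℝ) ≠ 0 := by linarith
  have h1 : (m : ℝ) - 1 ≠ 0 := by linarith
  rw [lam, theta_eq, thetaTwo_eq]
  field_simp
  ring

/-- For `m` points of an interval, the sum of the squared differences over all pairs is at most
`⌊m ^ 2 / 4⌋` times the squared length. -/
theorem mul_sum_sq_sub_sq_sum_le (m : ℕ) : ∀ (u : ℕ → ℝ), Monotone u →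
    m * ∑ s ∈ Finset.range m, u s ^ 2 - (∑ s ∈ Finset.range m, u s) ^ 2 ≤
      (m ^ 2 / 4 : ℕ) * (u (m - 1) - u 0) ^ 2 := by
  induction m using Nat.twoStepInduction with
  | zero => simp
  | one => simp
  | more m ih _ =>
    intro u hu
    -- Remove the two extreme points. With `D` the span, the inner pairs give `⌊m ^ 2 / 4⌋ * D ^ 2`,
    -- each inner point paired with both extremes gives at most `D ^ 2`, and the extreme pair gives
    -- `D ^ 2`.
    have h := ih (fun s => u (s + 1)) fun a b hab => hu (by omega)
    have hspan : (u (m - 1 + 1) - u (0 + 1)) ^ 2 ≤ (u (m + 1) - u 0) ^ 2 := by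
      -- For `m = 0` truncated subtraction makes both indices on the left `1`, so the inner span is
      -- zero.
      rcases Nat.eq_zero_or_pos m with rfl | hm
      · simpa using sq_nonneg _
      · have h1 : u 0 ≤ u (0 + 1) := hu (by omega)
        have h2 : u (0 + 1) ≤ u (m - 1 + 1) := hu (by omega)
        have h3 : u (m - 1 + 1) ≤ u (m + 1) := hu (by omega)
        exact pow_le_pow_left₀ (by linarith) (by linarith) 2
    have hin : ∑ s ∈ Finset.range m, ((u (s + 1) - u 0) ^ 2 + (u (m + 1) - u (s + 1)) ^ 2) ≤
        m * (u (m + 1) - u 0) ^ 2 := by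
      have := Finset.sum_le_card_nsmul (Finset.range m)
        (fun s => (u (s + 1) - u 0) ^ 2 + (u (m + 1) - u (s + 1)) ^ 2)
        ((u (m + 1) - u 0) ^ 2) fun s hs => by
          rw [Finset.mem_range] at hs
          have h1 : u 0 ≤ u (s + 1) := hu (by omega)
          have h2 : u (s + 1) ≤ u (m + 1) := hu (by omega)
          nlinarith [mul_nonneg (sub_nonneg.2 h1) (sub_nonneg.2 h2)]
      simpa using this
    have hexp : ∑ s ∈ Finset.range m, ((u (s + 1) - u 0) ^ 2 + (u (m + 1) - u (s + 1)) ^ 2) =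
        2 * ∑ s ∈ Finset.range m, u (s + 1) ^ 2 -
          2 * (u 0 + u (m + 1)) * ∑ s ∈ Finset.range m, u (s + 1) +
            m * (u 0 ^ 2 + u (m + 1) ^ 2) := by
      have : (m : ℝ) * (u 0 ^ 2 + u (m + 1) ^ 2) =
          ∑ s ∈ Finset.range m, (u 0 ^ 2 + u (m + 1) ^ 2) := by
        rw [Finset.sum_const, Finset.card_range, nsmul_eq_mul]
      rw [this, Finset.mul_sum, Finset.mul_sum, ← Finset.sum_sub_distrib,
        ← Finset.sum_add_distrib]
      exact Finset.sum_congr rfl fun s _ => by ring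
    have hq : (((m + 2) ^ 2 / 4 : ℕ) : ℝ) = (m ^ 2 / 4 : ℕ) + m + 1 := by
      have : (m + 2) ^ 2 / 4 = m ^ 2 / 4 + m + 1 := by
        rw [show (m + 2) ^ 2 = m ^ 2 + 4 * (m + 1) by ring, Nat.add_mul_div_left _ _ (by norm_num)]
        ring
      rw [this]
      push_cast
      ring
    have hmul := mul_le_mul_of_nonneg_left hspan (Nat.cast_nonneg (α := ℝ) (m ^ 2 / 4))
    rw [hq, show m + 2 - 1 = m + 1 by omega, Finset.sum_range_succ, Finset.sum_range_succ',
      Finset.sum_range_succ, Finset.sum_range_succ']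
    rw [hexp] at hin
    push_cast at h ⊢
    linarith

theorem mul_knotSqSum_sub_sq_knotSum_nonneg (m : ℕ) (i : ℤ) :
    0 ≤ m * knotSqSum x m i - knotSum x m i ^ 2 := by
  have := sq_sum_le_card_mul_sum_sq (s := Finset.range m) (f := fun s : ℕ => knot x (i + 1 + s))
  rw [Finset.card_range] at this
  exact sub_nonneg.2 this

theorem lam_nonneg {m : ℕ} (hm : 2 ≤ m) (j : ℤ) : 0 ≤ lam m x j := by
  have h2 : (2 : ℝ) ≤ m := by exact_mod_cast hm
  rw [lam_eq hm]
  exact div_nonneg (mul_knotSqSum_sub_sq_knotSum_nonneg m _) (mul_nonneg (sq_nonneg _) (by linarith))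

theorem lam_le {m : ℕ} (hm : 2 ≤ m) (hx : StrictMono x) (j : ℤ) :
    lam m x j ≤ (m ^ 2 / 4 : ℕ) / (m - 1) * ((knot x j - knot x (j - m + 1)) / m) ^ 2 := by
  have h2 : (2 : ℝ) ≤ m := by exact_mod_cast hm
  have h0 : (m : ℝ) ≠ 0 := by linarith
  have h1 : (m : ℝ) - 1 ≠ 0 := by linarith
  have h := mul_sum_sq_sub_sq_sum_le m (fun s => knot x (j - m + 1 + s))
    fun a b hab => knot_mono hx (by omega)
  have e : j - m + 1 + ((m - 1 : ℕ) : ℤ) = j := by omega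
  simp only [e, Nat.cast_zero, add_zero] at h
  have e2 : ((m ^ 2 / 4 : ℕ) : ℝ) / (m - 1) * ((knot x j - knot x (j - m + 1)) / m) ^ 2 =
      (m ^ 2 / 4 : ℕ) * (knot x j - knot x (j - m + 1)) ^ 2 / ((m : ℝ) ^ 2 * (m - 1)) := by
    field_simp
  rw [lam_eq hm, e2]
  exact div_le_div_of_nonneg_right h (mul_nonneg (sq_nonneg _) (by linarith))

/-! ### The coefficient functionals: values on quadratics and uniform bounds. -/

theorem theta_sub_theta_pred (m : ℕ) (j : ℤ) :
    theta m x j - theta m x (j - 1) = (knot x j - knot x (j - m)) / m := by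
  have h1 := knotSum_succ (x := x) m (j - m - 1)
  have h2 := knotSum_succ' (x := x) m (j - m)
  have e : j - m - 1 + m + 1 = j := by ring
  have e' : j - 1 - (m : ℤ) = j - m - 1 := by ring
  rw [e] at h1
  rw [theta_eq, theta_eq, ← sub_div, e']
  congr 1
  linarith

theorem mu_apply (m : ℕ) (hm : 2 ≤ m) (hx : StrictMono x) (j : ℤ) (f : C(I x, ℝ)) :
    mu m hm x hx j f = f (thetaPt m hm x hx j) - lam m x j *
      ((theta m x (j + 1) - theta m x (j - 1))⁻¹ *
        ((theta m x (j + 1) - theta m x j)⁻¹ *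
            (f (thetaPt m hm x hx (j + 1)) - f (thetaPt m hm x hx j)) -
          (theta m x j - theta m x (j - 1))⁻¹ *
            (f (thetaPt m hm x hx j) - f (thetaPt m hm x hx (j - 1))))) := by
  simp [mu, divDiff, thetaPt]

theorem S₂_apply (m : ℕ) (hm : 2 ≤ m) (hx : StrictMono x) (f : C(I x, ℝ)) (y : I x) :
    S₂ m hm x hx f y =
      ∑ j ∈ Finset.range (m + n), mu m hm x hx j f * bspline x m (j - m) y := by
  simp only [S₂, _root_.sum_apply, ContinuousMap.sum_apply,
    ContinuousLinearMap.smulRight_apply, ContinuousMap.smul_apply, smul_eq_mul]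
  rfl

/-- The differences of the knot averages around `j` dominate the span of the knots that enter
`λ j`; in particular they are positive unless `λ j = 0`. -/
theorem lam_eq_zero_or {m : ℕ} (hm : 2 ≤ m) (hx : StrictMono x) (j : ℤ) :
    lam m x j = 0 ∨ ∃ h : ℝ, 0 < h ∧ h ≤ theta m x j - theta m x (j - 1) ∧
      h ≤ theta m x (j + 1) - theta m x j ∧ lam m x j ≤ (m ^ 2 / 4 : ℕ) / (m - 1) * h ^ 2 := by
  have hm0 : (0 : ℝ) < m := by exact_mod_cast (by omega : 0 < m)
  have hl := lam_le hm hx j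
  have h1 := theta_sub_theta_pred (x := x) m j
  have h2 := theta_sub_theta_pred (x := x) m (j + 1)
  have e : j + 1 - (m : ℤ) = j - m + 1 := by ring
  rw [add_sub_cancel_right, e] at h2
  rcases (knot_mono hx (show j - m + 1 ≤ j by omega)).eq_or_lt with h | h
  · left
    refine le_antisymm ?_ (lam_nonneg hm j)
    simpa [h] using hl
  · right
    refine ⟨_, div_pos (sub_pos.2 h) hm0, ?_, ?_, hl⟩
    · rw [h1]
      have := knot_mono hx (show j - m ≤ j - m + 1 by omega)
      gcongr
    · rw [h2]
      have := knot_mono hx (show j ≤ j + 1 by omega)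
      gcongr

theorem mu_polynomial (m : ℕ) (hm : 2 ≤ m) (hx : StrictMono x) (j : ℤ) {p : Polynomial ℝ}
    (hp : p.natDegree ≤ 2) :
    mu m hm x hx j (p.toContinuousMapOn (I x)) =
      p.coeff 0 + p.coeff 1 * theta m x j + p.coeff 2 * thetaTwo m x j := by
  have hev : ∀ y : ℝ, p.eval y = p.coeff 0 + p.coeff 1 * y + p.coeff 2 * y ^ 2 := fun y => by
    rw [Polynomial.eval_eq_sum_range' (n := 3) (by omega)]
    simp [Finset.sum_range_succ]
  have ht : thetaTwo m x j = theta m x j ^ 2 - lam m x j := by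
    rw [lam]
    ring
  rw [mu_apply, ht]
  simp only [Polynomial.toContinuousMapOn_apply, Polynomial.toContinuousMap_apply, thetaPt, hev]
  -- Nodes may coincide only when `lam` vanishes, and then the divided difference drops out whatever
  -- its default value.
  rcases lam_eq_zero_or hm hx j with h | ⟨h, h0, h1, h2, -⟩
  · rw [h]
    ring
  · have d1 : theta m x j - theta m x (j - 1) ≠ 0 := by linarith
    have d2 : theta m x (j + 1) - theta m x j ≠ 0 := by linarith
    have d3 : theta m x (j + 1) - theta m x (j - 1) ≠ 0 := by linarith
    field_simp
    ring

theorem S₂_polynomial (m : ℕ) (hm : 2 ≤ m) (hn : 1 ≤ n) (hx : StrictMono x) {p : Polynomial ℝ}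
    (hp : p.natDegree ≤ 2) :
    S₂ m hm x hx (p.toContinuousMapOn (I x)) = p.toContinuousMapOn (I x) := by
  ext y
  have h2 : (2 : ℝ) ≤ m := by exact_mod_cast hm
  have h0 : (m : ℝ) ≠ 0 := by linarith
  have h1 : (m : ℝ) - 1 ≠ 0 := by linarith
  have s0 := sum_bspline hx hn y.2 m
  have s1 := sum_knotSum_mul_bspline hx hn y.2 m
  have s2 := sum_knotSum_sq_sub_mul_bspline hx hn y.2 m
  have key : ∀ j ∈ Finset.range (m + n),
      mu m hm x hx j (p.toContinuousMapOn (I x)) * bspline x m (j - m) y =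
        p.coeff 0 * bspline x m (j - m) y +
        p.coeff 1 / m * (knotSum x m (j - m) * bspline x m (j - m) y) +
        p.coeff 2 / (m * (m - 1)) *
          ((knotSum x m (j - m) ^ 2 - knotSqSum x m (j - m)) * bspline x m (j - m) y) := by
    intro j _
    rw [mu_polynomial m hm hx j hp, theta_eq, thetaTwo_eq]
    ring
  rw [S₂_apply, Finset.sum_congr rfl key, Finset.sum_add_distrib, Finset.sum_add_distrib,
    ← Finset.mul_sum, ← Finset.mul_sum, ← Finset.mul_sum, s0, s1, s2]
  simp only [Polynomial.toContinuousMapOn_apply, Polynomial.toContinuousMap_apply]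
  rw [Polynomial.eval_eq_sum_range' (n := 3) (by omega)]
  simp only [Finset.sum_range_succ, Finset.sum_range_zero]
  field_simp
  ring

theorem abs_mu_le (m : ℕ) (hm : 2 ≤ m) (hx : StrictMono x) (j : ℤ) (f : C(I x, ℝ)) :
    |mu m hm x hx j f| ≤ (1 + 2 * ((m ^ 2 / 4 : ℕ) / (m - 1))) * ‖f‖ := by
  have h2 : (2 : ℝ) ≤ m := by exact_mod_cast hm
  have hf : ∀ z, |f z| ≤ ‖f‖ := fun z => f.norm_coe_le_norm z
  have hK : 0 ≤ ((m ^ 2 / 4 : ℕ) : ℝ) / (m - 1) := div_nonneg (Nat.cast_nonneg _) (by linarith)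
  have hN := norm_nonneg f
  have hl := lam_nonneg (x := x) hm j
  rw [mu_apply]
  have hq := hf (thetaPt m hm x hx j)
  have hr := hf (thetaPt m hm x hx (j + 1))
  have hp := hf (thetaPt m hm x hx (j - 1))
  rcases lam_eq_zero_or hm hx j with h | ⟨h, h0, h1, h2, h3⟩
  · rw [h, zero_mul, sub_zero]
    exact hq.trans (le_mul_of_one_le_left hN (by linarith))
  · generalize f (thetaPt m hm x hx j) = fq at *
    generalize f (thetaPt m hm x hx (j + 1)) = fr at *
    generalize f (thetaPt m hm x hx (j - 1)) = fp at *
    have hd : theta m x (j + 1) - theta m x (j - 1) =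
      (theta m x (j + 1) - theta m x j) + (theta m x j - theta m x (j - 1)) := by ring
    rw [hd]
    generalize theta m x (j + 1) - theta m x j = d₂ at *
    generalize theta m x j - theta m x (j - 1) = d₁ at *
    generalize lam m x j = l at *
    generalize ((m ^ 2 / 4 : ℕ) : ℝ) / (m - 1) = K at *
    have p1 : 0 < d₁ := by linarith
    have p2 : 0 < d₂ := by linarith
    -- Both gaps dominate `h`, so `h ^ 2 ≤ d₁ * d₂` cancels the knot spacing.
    have hlK : l / (d₁ * d₂) ≤ K := by
      rw [div_le_iff₀ (mul_pos p1 p2)]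
      refine h3.trans (mul_le_mul_of_nonneg_left ?_ hK)
      rw [sq]
      exact mul_le_mul h1 h2 h0.le p1.le
    -- Up to the factor `1 / (d₁ * d₂)`, this is a mean of `fr - fq` and `-(fq - fp)` with weights
    -- proportional to `d₁` and `d₂`; each is at most `2 * ‖f‖` in absolute value.
    have hD : |(d₂ + d₁)⁻¹ * (d₂⁻¹ * (fr - fq) - d₁⁻¹ * (fq - fp))| ≤ 2 * ‖f‖ / (d₁ * d₂) := by
      have e : (d₂ + d₁)⁻¹ * (d₂⁻¹ * (fr - fq) - d₁⁻¹ * (fq - fp)) =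
          (d₁ * (fr - fq) - d₂ * (fq - fp)) / (d₂ + d₁) / (d₁ * d₂) := by
        field_simp
      rw [e, abs_div _ (d₁ * d₂), abs_of_pos (mul_pos p1 p2)]
      refine div_le_div_of_nonneg_right ?_ (mul_pos p1 p2).le
      rw [abs_div, abs_of_pos (show 0 < d₂ + d₁ by linarith), div_le_iff₀ (by linarith)]
      rw [abs_le] at hp hq hr ⊢
      constructor <;> nlinarith
    calc |fq - l * _| ≤ |fq| + |l * _| := abs_sub _ _
      _ ≤ ‖f‖ + l * (2 * ‖f‖ / (d₁ * d₂)) := by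
        rw [abs_mul, abs_of_nonneg hl]
        exact add_le_add hq (mul_le_mul_of_nonneg_left hD hl)
      _ = ‖f‖ + 2 * (l / (d₁ * d₂)) * ‖f‖ := by ring
      _ ≤ (1 + 2 * K) * ‖f‖ := by nlinarith

/-- Equality holds for odd `m`; for `m = 2 * k` the claim reduces to `2 * k ^ 2 ≤ (k + 1) * (2 * k -
1)`, that is `1 ≤ k`. -/
theorem one_add_two_mul_le_floor {m : ℕ} (hm : 2 ≤ m) :
    1 + 2 * (((m ^ 2 / 4 : ℕ) : ℝ) / (m - 1)) ≤ (⌊((m : ℝ) + 4) / 2⌋ : ℝ) := by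
  rcases Nat.even_or_odd' m with ⟨k, rfl | rfl⟩
  · have hk : (1 : ℝ) ≤ k := by exact_mod_cast (by omega : 1 ≤ k)
    have e : (2 * k) ^ 2 / 4 = k ^ 2 := by
      rw [show (2 * k) ^ 2 = 4 * k ^ 2 by ring]
      omega
    have e2 : ⌊(((2 * k : ℕ) : ℝ) + 4) / 2⌋ = (k : ℤ) + 2 := by
      rw [Int.floor_eq_iff]
      push_cast
      constructor <;> linarith
    rw [e, e2]
    push_cast
    have : (k : ℝ) ^ 2 / (2 * k - 1) ≤ (k + 1) / 2 := by
      rw [div_le_div_iff₀ (by linarith) (by norm_num)]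
      nlinarith
    linarith
  · have hk : (1 : ℝ) ≤ k := by exact_mod_cast (by omega : 1 ≤ k)
    have e : (2 * k + 1) ^ 2 / 4 = k * (k + 1) := by
      rw [show (2 * k + 1) ^ 2 = 4 * (k * (k + 1)) + 1 by ring]
      omega
    have e2 : ⌊(((2 * k + 1 : ℕ) : ℝ) + 4) / 2⌋ = (k : ℤ) + 2 := by
      rw [Int.floor_eq_iff]
      push_cast
      constructor <;> linarith
    rw [e, e2]
    push_cast
    have : (k : ℝ) * (k + 1) / (2 * k + 1 - 1) = (k + 1) / 2 := by
      rw [add_sub_cancel_right]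
      field_simp
    linarith

/-! ### The operator norm and the conclusion. -/

theorem norm_S₂_le (m : ℕ) (hm : 2 ≤ m) (hn : 1 ≤ n) (hx : StrictMono x) :
    ‖S₂ m hm x hx‖ ≤ 1 + 2 * (((m ^ 2 / 4 : ℕ) : ℝ) / (m - 1)) := by
  have h2 : (2 : ℝ) ≤ m := by exact_mod_cast hm
  have hK : 0 ≤ ((m ^ 2 / 4 : ℕ) : ℝ) / (m - 1) := div_nonneg (Nat.cast_nonneg _) (by linarith)
  refine ContinuousLinearMap.opNorm_le_bound _ (by linarith) fun f => ?_
  rw [ContinuousMap.norm_le _ (mul_nonneg (by linarith) (norm_nonneg f))]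
  intro y
  rw [S₂_apply, Real.norm_eq_abs]
  calc _ ≤ ∑ j ∈ Finset.range (m + n), |mu m hm x hx j f * bspline x m (j - m) y| :=
        Finset.abs_sum_le_sum_abs _ _
    _ ≤ ∑ j ∈ Finset.range (m + n),
        (1 + 2 * (((m ^ 2 / 4 : ℕ) : ℝ) / (m - 1))) * ‖f‖ * bspline x m (j - m) y := by
      refine Finset.sum_le_sum fun j _ => ?_
      have hB := bspline_nonneg hx (y : ℝ) m (j - m)
      rw [abs_mul, abs_of_nonneg hB]
      exact mul_le_mul_of_nonneg_right (abs_mu_le m hm hx j f) hB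
    _ = _ := by rw [← Finset.mul_sum, sum_bspline hx hn y.2, mul_one]

end Splines

end QuasiInterpolant

theorem mainTheorem4 (m : ℕ) (hm : 2 ≤ m) (n : ℕ) (hn : 1 ≤ n)
    (x : Fin (n + 1) → ℝ) (hx : StrictMono x) :
    (∀ p : Polynomial ℝ, p.natDegree ≤ 2 →
      QuasiInterpolant.S₂ m hm x hx (p.toContinuousMapOn (QuasiInterpolant.I x)) =
        p.toContinuousMapOn (QuasiInterpolant.I x)) ∧
    ‖QuasiInterpolant.S₂ m hm x hx‖ ≤ (⌊((m : ℝ) + 4) / 2⌋ : ℝ) :=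
  ⟨fun _ hp => QuasiInterpolant.S₂_polynomial m hm hn hx hp,
    (QuasiInterpolant.norm_S₂_le m hm hn hx).trans
      (QuasiInterpolant.one_add_two_mul_le_floor hm)⟩
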